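/- A (constrained) network game consists of a finite nonempty set of agents $\mathcal N$, a nonempty set $\mathcal E$ of edges (nonempty subsets of $\mathcal N$), capacities $\alpha_C\ge 0$ ($C\in\mathcal E$, possibly larger than $1$), budgets $\beta_i>0$ ($i\in\mathcal N$), and payoff functions $u_i:\prod_{C\in\mathcal E}[0,\alpha_C]\to\mathbb R$. Put $\mathcal E^i=\{C\in\mathcal E: i\in C\}$, $\mathcal E^C=\bigcup_{i\in C}\mathcal E^i$, and let $X^{\alpha,\beta}$ be the set of $x\in\prod_C[0,\alpha_C]$ with $\sum_{C\ni i}x_C\le\beta_i$ for all $i$. Write $(y^i,x^{-i})$ (resp. $(y^C,x^{-C})$) for the network equal to $y$ on $\mathcal E^i$ (resp. $\mathcal E^C$) and to $x$ on the other edges. A network $x$ is fully stable if 1. $x\in X^{\alpha,\beta}$; 2. $u_i(y^i,x^{-i})\le u_i(x)$ for every $i\in\mathcal N$ and every $y^i\in\prod_{C\in\mathcal E^i}[0,x_C]$; 3. for every $C\in\mathcal E$ and $y^C\in\prod_{C'\in\mathcal E^C}[0,\alpha_{C'}]$ with $y^C_C\ge x_C$, $y^C_{C'}\le x_{C'}$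 for all $C'\in\mathcal E^C\setminus\{C\}$, and $u_i(y^C,x^{-C})>u_i(x)$ for all $i\in C$, there is $j\in C$ with $\sum_{C'\in\mathcal E^j}y^C_{C'}>\beta_j$. Suppose that the game is bipartite, i.e. $\mathcal N=U\sqcup V$ and every edge is $\{i,j\}$ with $i\in U$, $j\in V$; that every $u_i$ is continuous and is concave in each weight separately; that the game is separable, $u_i(x)=\sum_{C\in\mathcal E}u_{i,C}(x_C)$; and that there are no externalities, $u_i(x)=u_i(x^i,y^{-i})$ for all $x\in X^{\alpha,\beta}$ and all $y^{-i}\in\prod_{C\not\ni i}[0,\alpha_C]$, so that $u_i$ may be written as a function of $x^i$. Suppose that all $\alpha_C$ and $\beta_i$ are integers, and that each $u_i$ is piecewise affine in each weight, with slope changes only at integers. Consider Generalized Deferred Acceptance (GDA) with integral choices. Start with $x=0$ and current capacities $a=\alpha$, and repeat: * Each $i\in U$ chooses an integral maximizer $x'^i$ of $u_i$ over the $y^i\in\prod_{C\ni i}[x_C,a_C]$ with $\sum_{C\ni i}y^i_C\le\beta_i$. If $x'=x$, stop and return $x$. * Otherwise each $j\in V$ chooses an integral maximizer of $u_j$ over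 the $y^j\in\prod_{C\ni j}[0,x'_C]$ with $\sum_{C\ni j}y^j_C\le\beta_j$. The resulting network is the new $x$, and for each $C$ with $x_C<x'_C$ the capacity $a_C$ is set to $x_C$. This completes one (full) step. On each of the two sides, ties in the argmax are broken by any of the following rules: arbitrarily; choosing the zero vector if it is a maximizer and otherwise arbitrarily; choosing the agent's current weights ($x^i$ for $i\in U$, $x'^j$ for $j\in V$) if they form a maximizer and otherwise arbitrarily. Then all the required integral maximizers exist whatever choices were made before, and every execution of GDA terminates after at most $\sum_{C\in\mathcal E}\alpha_C$ steps and returns a fully stable network with integral weights. -/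

import Mathlib

/-- A constrained network game: agents `N`, a nonempty set of edges (nonempty coalitions of agents),
a capacity for every edge and a budget for every agent. A network is a weight function
`edges → ℝ`; the payoff functions matter only on the box `∏ [0, capacity C]`, and all notions below
evaluate and constrain them only there. Capacities may exceed `1`. -/
structure NetworkGame (N : Type*) where
  edges : Finset (Finset N)
  edges_nonempty : edges.Nonempty
  nonempty_of_mem : ∀ C ∈ edges, C.Nonempty
  payoff : (edges → ℝ) → N → ℝ
  capacity : edges → ℝ
  capacity_nonneg : ∀ C, 0 ≤ capacity C
  budget : N → ℝ
  budget_pos : ∀ i, 0 < budget i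

namespace NetworkGame

variable {N : Type*} [DecidableEq N] (Γ : NetworkGame N)

/-- The networks `x` with `x C ∈ [0, capacity C]` for every edge (the domain of the payoffs). -/
def box : Set (Γ.edges → ℝ) := {x | ∀ C, x C ∈ Set.Icc 0 (Γ.capacity C)}

/-- The total weight that the network `x` puts on the edges containing agent `i`. -/
def load (x : Γ.edges → ℝ) (i : N) : ℝ := ∑ C with i ∈ C.1, x C

/-- The networks that respect all capacities and all budgets. -/
def feasible : Set (Γ.edges → ℝ) := {x | x ∈ Γ.box ∧ ∀ i, Γ.load x i ≤ Γ.budget i}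

/-- The network that equals `y` on the edges meeting the set of agents `S` and `x` elsewhere.
For an agent `i` and `S = {i}` this is `(y^i, x^{-i})`; for a coalition `S = C` it is
`(y^C, x^{-C})`. -/
def splice (S : Finset N) (y x : Γ.edges → ℝ) : Γ.edges → ℝ :=
  fun C => if ∃ i ∈ S, i ∈ C.1 then y C else x C

/-- All weights are integers. -/
def IsIntegral (x : Γ.edges → ℝ) : Prop := ∀ C, ∃ k : ℤ, x C = k

/-! ### Full stability -/

/-- No agent gains by lowering weights of its own edges, and no coalition `C` can, within the
capacities and the budgets of its members, make all its members strictly better off by (weakly)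
raising the weight of `C` and lowering the weights of other edges of its members. -/
def FullyStable (x : Γ.edges → ℝ) : Prop :=
  x ∈ Γ.feasible ∧
  (∀ (i : N) (y : Γ.edges → ℝ),
    (∀ C : Γ.edges, i ∈ C.1 → 0 ≤ y C ∧ y C ≤ x C) →
      Γ.payoff (Γ.splice {i} y x) i ≤ Γ.payoff x i) ∧
  (∀ (C : Γ.edges) (y : Γ.edges → ℝ),
    (∀ C' : Γ.edges, (∃ i ∈ C.1, i ∈ C'.1) → y C' ∈ Set.Icc 0 (Γ.capacity C')) →
    x C ≤ y C →
    (∀ C' : Γ.edges, C' ≠ C → (∃ i ∈ C.1, i ∈ C'.1) → y C' ≤ x C') →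
    (∀ i ∈ C.1, Γ.payoff x i < Γ.payoff (Γ.splice C.1 y x) i) →
      ∃ j ∈ C.1, Γ.budget j < Γ.load y j)

/-! ### Assumptions on games -/

/-- Every payoff function is continuous. -/
def Continuous : Prop := ∀ i, ContinuousOn (fun x => Γ.payoff x i) Γ.box

/-- The payoff is a sum over the edges of functions of the weight of that edge alone. -/
def Separable : Prop :=
  ∃ w : Γ.edges → ℝ → N → ℝ, ∀ x ∈ Γ.box, ∀ i, Γ.payoff x i = ∑ C, w C (x C) i

/-- Every payoff function is componentwise concave. -/
def Concave : Prop :=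
  ∀ (i : N) (C : Γ.edges), ∀ x ∈ Γ.box,
    ConcaveOn ℝ (Set.Icc 0 (Γ.capacity C)) (fun t => Γ.payoff (Function.update x C t) i)

/-- The payoff of an agent does not depend on the weights of the edges it does not belong to. -/
def NoExternalities : Prop :=
  ∀ i, ∀ x ∈ Γ.feasible, ∀ y ∈ Γ.box, Γ.payoff x i = Γ.payoff (Γ.splice {i} x y) i

/-- `U` and `V` partition the agents, and every edge joins an agent of `U` to an agent of `V`. -/
def IsBipartition (U V : Set N) : Prop :=
  Disjoint U V ∧ U ∪ V = Set.univ ∧ ∀ C ∈ Γ.edges, ∃ i ∈ U, ∃ j ∈ V, C = {i, j}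

/-- Capacities and budgets are integers. -/
def IntegralConstraints : Prop :=
  (∀ C, ∃ k : ℤ, Γ.capacity C = k) ∧ ∀ i, ∃ k : ℤ, Γ.budget i = k

/-- Every payoff function is piecewise affine in each weight, with slope changes only at integers:
it is affine in that weight on each interval `[k, k + 1] ⊆ [0, capacity C]`. -/
def PiecewiseAffine : Prop :=
  ∀ (i : N) (C : Γ.edges), ∀ x ∈ Γ.box, ∀ k : ℕ, (k : ℝ) + 1 ≤ Γ.capacity C →
    ∃ a b : ℝ, ∀ t ∈ Set.Icc (k : ℝ) (k + 1), Γ.payoff (Function.update x C t) i = a + b * t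

/-! ### Generalized Deferred Acceptance -/

/-- The networks whose weights on the edges of agent `i` lie between `lo` and `hi` and respect the
budget of `i`. There is no condition on the other edges. -/
def options (i : N) (lo hi : Γ.edges → ℝ) : Set (Γ.edges → ℝ) :=
  {y | (∀ C : Γ.edges, i ∈ C.1 → lo C ≤ y C ∧ y C ≤ hi C) ∧ Γ.load y i ≤ Γ.budget i}

/-- The elements of `options i lo hi` that maximize the payoff of agent `i`, the weights of the edges
not containing `i` being those of the network `z`. -/
def argmax (i : N) (lo hi z : Γ.edges → ℝ) : Set (Γ.edges → ℝ) :=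
  {y | y ∈ Γ.options i lo hi ∧ ∀ y' ∈ Γ.options i lo hi,
    Γ.payoff (Γ.splice {i} y' z) i ≤ Γ.payoff (Γ.splice {i} y z) i}

/-- Ways to choose an element of an argmax that has several elements: any element; the zero vector if
it is a maximizer and otherwise any element; the vector of current weights if it is a maximizer
and otherwise any element. -/
inductive TieRule
  | arbitrary
  | preferZero
  | preferCurrent

/-- The choice `y` of agent `i` among `argmax i lo hi z` obeys the tie rule. -/
def Obeys (i : N) (lo hi z y : Γ.edges → ℝ) : TieRule → Prop
  | .arbitrary => True
  | .preferZero => 0 ∈ Γ.argmax i lo hi z → ∀ C : Γ.edges, i ∈ C.1 → y C = 0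
  | .preferCurrent => z ∈ Γ.argmax i lo hi z → ∀ C : Γ.edges, i ∈ C.1 → y C = z C

/-- On the edges of agent `i`, `y` is an integral maximizer, chosen according to the tie rule. -/
def IsChoice (τ : TieRule) (i : N) (lo hi z y : Γ.edges → ℝ) : Prop :=
  y ∈ Γ.argmax i lo hi z ∧ (∀ C : Γ.edges, i ∈ C.1 → ∃ k : ℤ, y C = k) ∧
    Γ.Obeys i lo hi z y τ

/-- The variables of the algorithm: the current network and the current capacities. -/
structure GDAState where
  weight : Γ.edges → ℝ
  cap : Γ.edges → ℝ

/-- Initially all weights are zero and the capacities are those of the game. -/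
def gdaInit : Γ.GDAState := ⟨0, Γ.capacity⟩

/-- `p` is a network that the agents of `U` may propose: each of them raises the weights of its
edges, up to the current capacities and within its budget, so as to maximize its payoff. -/
def IsProposal (τ : TieRule) (U : Set N) (s : Γ.GDAState) (p : Γ.edges → ℝ) : Prop :=
  ∀ i ∈ U, Γ.IsChoice τ i s.weight s.cap s.weight p

/-- `r` is a network to which the agents of `V` may reduce the proposal `p`: each of them lowers the
weights of its edges, within its budget, so as to maximize its payoff. -/
def IsDisposal (τ : TieRule) (V : Set N) (p r : Γ.edges → ℝ) : Prop :=
  ∀ j ∈ V, Γ.IsChoice τ j 0 p p r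

/-- The state after the proposal `p` was reduced to `r`: the capacity of every reduced edge drops to
its new weight. -/
noncomputable def gdaNext (s : Γ.GDAState) (p r : Γ.edges → ℝ) : Γ.GDAState :=
  ⟨r, fun C => if r C < p C then r C else s.cap C⟩

/-- `GDAReaches τU τV U V n s`: some execution of the algorithm is in state `s` after `n` full steps.
A full step is a proposal different from the current network, followed by a disposal. -/
inductive GDAReaches (τU τV : TieRule) (U V : Set N) : ℕ → Γ.GDAState → Prop
  | init : GDAReaches τU τV U V 0 Γ.gdaInit
  | step {n : ℕ} {s : Γ.GDAState} {p r : Γ.edges → ℝ} (hs : GDAReaches τU τV U V n s)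
      (hp : Γ.IsProposal τU U s p) (hne : p ≠ s.weight) (hr : Γ.IsDisposal τV V p r) :
      GDAReaches τU τV U V (n + 1) (Γ.gdaNext s p r)

/-- Some execution of the algorithm terminates after `n` full steps and returns `x`: the agents of `U`
propose the current network `x` itself. -/
def GDAReturns (τU τV : TieRule) (U V : Set N) (n : ℕ) (x : Γ.edges → ℝ) : Prop :=
  ∃ s : Γ.GDAState, Γ.GDAReaches τU τV U V n s ∧ Γ.IsProposal τU U s s.weight ∧ s.weight = x

end NetworkGame

/-! Separability and the absence of externalities turn each payoff, up to a constant, into a sum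
over own edges of concave univariate functions that are affine between integers
(`exists_isDecomposition`). For such a sum, an integral point from which no unit move (add, drop, or
exchange one unit) is profitable maximizes over all real options: a Lagrange multiplier for the
budget certifies this (`LocallyOptimal.value_le`). Hence integral maximizers exist, and everything
reduces to inequalities between marginal gains.

The algorithm preserves two one-sided facts. An agent of `U` never regrets a unit it holds: even if
it could also lower weights, its proposal would stay optimal within the current capacities
(`locallyOptimal_zero_proposal`). An agent of `V` that has cut an edge never wants more of it: later
proposals only enlarge its choice, so the edge stays saturated (`Saturated.of_locallyOptimal`).

On return, an edge below its current capacity is saturated for its end in `U`; an edge at a current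
capacity that has dropped is saturated for its end in `V`; an edge at its original capacity cannot
be raised. So no edge blocks. Termination holds because the sum of the gaps between current capacity
and weight drops by at least one per step (`sum_gap_next`). Only optimality and integrality of the
choices are used for this, so the tie rule plays no role beyond existence. -/

namespace NetworkGame

/-! ### Reduction to univariate concave functions -/

variable {N : Type*} [DecidableEq N] {Γ : NetworkGame N}

/-- The payoffs are, up to constants, sums over the own edges of univariate functions that are
concave on `[0, capacity C]` and affine between consecutive integers. -/
structure IsDecomposition (Γ : NetworkGame N) (f : N → Γ.edges → ℝ → ℝ) (c : N → ℝ) : Prop where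
  payoff_eq : ∀ i, ∀ x ∈ Γ.box, Γ.payoff x i = ∑ C with i ∈ C.1, f i C (x C) + c i
  concave : ∀ i C, ConcaveOn ℝ (Set.Icc 0 (Γ.capacity C)) (f i C)
  affine : ∀ i C, ∀ k : ℕ, (k : ℝ) + 1 ≤ Γ.capacity C →
    ∃ a b : ℝ, ∀ t ∈ Set.Icc (k : ℝ) (k + 1), f i C t = a + b * t

omit [DecidableEq N] in
theorem zero_mem_box : (0 : Γ.edges → ℝ) ∈ Γ.box := fun C => ⟨le_rfl, Γ.capacity_nonneg C⟩

theorem zero_mem_feasible : (0 : Γ.edges → ℝ) ∈ Γ.feasible :=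
  ⟨zero_mem_box, fun i => by simpa [load] using (Γ.budget_pos i).le⟩

theorem update_mem_box {x : Γ.edges → ℝ} (hx : x ∈ Γ.box) {C : Γ.edges} {t : ℝ}
    (ht : t ∈ Set.Icc 0 (Γ.capacity C)) : Function.update x C t ∈ Γ.box := by
  intro C'
  by_cases h : C' = C
  · subst h; simpa using ht
  · simpa [Function.update_of_ne h] using hx C'

theorem exists_isDecomposition (hsep : Γ.Separable) (hconc : Γ.Concave)
    (hext : Γ.NoExternalities) (haff : Γ.PiecewiseAffine) :
    ∃ f c, Γ.IsDecomposition f c := by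
  obtain ⟨w, hw⟩ := hsep
  -- Up to a constant, each summand is the payoff as a function of one weight, the others being
  -- zero; so it inherits concavity and affine pieces.
  have hupd : ∀ (i : N) (C : Γ.edges), ∃ d : ℝ, ∀ t ∈ Set.Icc 0 (Γ.capacity C),
      w C t i = Γ.payoff (Function.update 0 C t) i + d := by
    intro i C
    refine ⟨-∑ C' ∈ Finset.univ.erase C, w C' 0 i, fun t ht => ?_⟩
    rw [hw _ (update_mem_box zero_mem_box ht), ← Finset.add_sum_erase _ _ (Finset.mem_univ C)]
    have : ∑ C' ∈ Finset.univ.erase C, w C' (Function.update (0 : Γ.edges → ℝ) C t C') i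
        = ∑ C' ∈ Finset.univ.erase C, w C' 0 i :=
      Finset.sum_congr rfl fun C' h => by
        rw [Function.update_of_ne (Finset.ne_of_mem_erase h)]; rfl
    rw [this, Function.update_self]; ring
  refine ⟨fun i C t => w C t i, fun i => ∑ C with i ∉ C.1, w C 0 i, ?_, ?_, ?_⟩
  · intro i x hx
    -- Comparing the zero network with the one that is zero on own edges and `x` elsewhere shows
    -- that the foreign summands have a constant total.
    have h1 := hext i 0 zero_mem_feasible x hx
    have hbox : Γ.splice {i} 0 x ∈ Γ.box := by
      intro C
      unfold splice
      split_ifs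
      · exact zero_mem_box C
      · exact hx C
    rw [hw _ zero_mem_box, hw _ hbox,
      ← Finset.sum_filter_add_sum_filter_not Finset.univ (fun C : Γ.edges => i ∈ C.1),
      ← Finset.sum_filter_add_sum_filter_not Finset.univ (fun C : Γ.edges => i ∈ C.1)] at h1
    have h2 : ∑ C with i ∈ C.1, w C (Γ.splice {i} 0 x C) i = ∑ C with i ∈ C.1, w C 0 i :=
      Finset.sum_congr rfl fun C h => by
        have : i ∈ C.1 := (Finset.mem_filter.1 h).2
        simp [splice, this]
    have h3 : ∑ C with i ∉ C.1, w C (Γ.splice {i} 0 x C) i = ∑ C with i ∉ C.1, w C (x C) i :=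
      Finset.sum_congr rfl fun C h => by
        have : i ∉ C.1 := (Finset.mem_filter.1 h).2
        simp [splice, this]
    rw [h2, h3] at h1
    rw [hw x hx, ← Finset.sum_filter_add_sum_filter_not Finset.univ (fun C : Γ.edges => i ∈ C.1)]
    simp only [Pi.zero_apply] at h1
    linarith
  · intro i C
    obtain ⟨d, hd⟩ := hupd i C
    exact ((hconc i C 0 zero_mem_box).add_const d).congr fun t ht => (hd t ht).symm
  · intro i C k hk
    obtain ⟨d, hd⟩ := hupd i C
    obtain ⟨a, b, hab⟩ := haff i C 0 zero_mem_box k hk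
    refine ⟨a + d, b, fun t ht => ?_⟩
    rw [hd t ⟨(Nat.cast_nonneg k).trans ht.1, ht.2.trans hk⟩, hab t ht]
    ring

/-! ### Marginal gains -/

/-- The sum of the univariate functions `f i C` over the edges of agent `i`. -/
def value (f : N → Γ.edges → ℝ → ℝ) (i : N) (x : Γ.edges → ℝ) : ℝ := ∑ C with i ∈ C.1, f i C (x C)

/-- What agent `i` gains from raising the weight of `C` from `t` to `t + 1`. -/
def gain (f : N → Γ.edges → ℝ → ℝ) (i : N) (C : Γ.edges) (t : ℝ) : ℝ := f i C (t + 1) - f i C t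

theorem add_one_le_of_lt {a b : ℝ} (ha : ∃ k : ℤ, a = k) (hb : ∃ k : ℤ, b = k) (h : a < b) :
    a + 1 ≤ b := by
  obtain ⟨k, rfl⟩ := ha
  obtain ⟨l, rfl⟩ := hb
  exact_mod_cast h

theorem sum_update {i : N} {C : Γ.edges} (hC : i ∈ C.1) (g : Γ.edges → ℝ → ℝ)
    (y : Γ.edges → ℝ) (t : ℝ) :
    ∑ C' with i ∈ C'.1, g C' (Function.update y C t C') =
      ∑ C' with i ∈ C'.1, g C' (y C') - g C (y C) + g C t := by
  have hmem : C ∈ Finset.univ.filter (fun C' : Γ.edges => i ∈ C'.1) := by simp [hC]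
  rw [← Finset.add_sum_erase _ _ hmem, ← Finset.add_sum_erase _ (fun C' => g C' (y C')) hmem]
  have : ∀ C' ∈ (Finset.univ.filter (fun C' : Γ.edges => i ∈ C'.1)).erase C,
      g C' (Function.update y C t C') = g C' (y C') := fun C' h => by
    rw [Function.update_of_ne (Finset.ne_of_mem_erase h)]
  rw [Finset.sum_congr rfl this, Function.update_self]
  ring

theorem value_update (f : N → Γ.edges → ℝ → ℝ) {i : N} {C : Γ.edges} (hC : i ∈ C.1)
    (y : Γ.edges → ℝ) (t : ℝ) :
    value f i (Function.update y C t) = value f i y - f i C (y C) + f i C t :=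
  sum_update hC (f i) y t

theorem load_update {i : N} {C : Γ.edges} (hC : i ∈ C.1) (y : Γ.edges → ℝ) (t : ℝ) :
    Γ.load (Function.update y C t) i = Γ.load y i - y C + t :=
  sum_update hC (fun _ t => t) y t

theorem load_mono {i : N} {x y : Γ.edges → ℝ} (h : ∀ C : Γ.edges, i ∈ C.1 → x C ≤ y C) :
    Γ.load x i ≤ Γ.load y i :=
  Finset.sum_le_sum fun C hC => h C (Finset.mem_filter.1 hC).2

theorem value_congr (f : N → Γ.edges → ℝ → ℝ) {i : N} {x y : Γ.edges → ℝ}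
    (h : ∀ C : Γ.edges, i ∈ C.1 → x C = y C) : value f i x = value f i y :=
  Finset.sum_congr rfl fun C hC => by rw [h C (Finset.mem_filter.1 hC).2]

theorem load_congr {i : N} {x y : Γ.edges → ℝ}
    (h : ∀ C : Γ.edges, i ∈ C.1 → x C = y C) : Γ.load x i = Γ.load y i :=
  Finset.sum_congr rfl fun C hC => h C (Finset.mem_filter.1 hC).2

theorem exists_int_load {x : Γ.edges → ℝ} (hx : Γ.IsIntegral x) (i : N) :
    ∃ k : ℤ, Γ.load x i = k := by
  choose k hk using hx
  exact ⟨∑ C with i ∈ C.1, k C, by simp [load, hk]⟩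

namespace IsDecomposition

variable {f : N → Γ.edges → ℝ → ℝ} {c : N → ℝ}

/-- The points `t` and `s + 1` are mirror-image convex combinations of `s` and `t + 1`; adding the
two concavity inequalities gives the claim. -/
theorem gain_anti (hf : Γ.IsDecomposition f c) (i : N) {C : Γ.edges} {s t : ℝ} (hs : 0 ≤ s)
    (hst : s ≤ t) (ht : t + 1 ≤ Γ.capacity C) : gain f i C t ≤ gain f i C s := by
  have hL : 0 < t + 1 - s := by linarith
  have ms : s ∈ Set.Icc 0 (Γ.capacity C) := ⟨hs, by linarith⟩
  have mt : t + 1 ∈ Set.Icc 0 (Γ.capacity C) := ⟨by linarith, ht⟩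
  have ha : 0 ≤ 1 / (t + 1 - s) := by positivity
  have hb : 0 ≤ (t - s) / (t + 1 - s) := div_nonneg (by linarith) hL.le
  have hab : 1 / (t + 1 - s) + (t - s) / (t + 1 - s) = 1 := by field_simp; ring
  have h1 := (hf.concave i C).2 ms mt ha hb hab
  have h2 := (hf.concave i C).2 mt ms ha hb hab
  have e1 : (1 / (t + 1 - s)) • s + ((t - s) / (t + 1 - s)) • (t + 1) = t := by
    simp only [smul_eq_mul]; field_simp; ring
  have e2 : (1 / (t + 1 - s)) • (t + 1) + ((t - s) / (t + 1 - s)) • s = s + 1 := by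
    simp only [smul_eq_mul]; field_simp; ring
  rw [e1] at h1
  rw [e2] at h2
  simp only [smul_eq_mul] at h1 h2
  set a := 1 / (t + 1 - s)
  set b := (t - s) / (t + 1 - s)
  unfold gain
  have hb' : b = 1 - a := by linarith
  rw [hb'] at h1 h2
  linarith

/-- At an integer `k` the marginal gain is the right-hand slope, hence a supergradient for
increases. Beyond `k + 1`, concavity is applied to `k + 1` as a point between `k` and `t`. -/
theorem sub_le_gain_right (hf : Γ.IsDecomposition f c) (i : N) {C : Γ.edges} {k t : ℝ}
    (hk : ∃ n : ℤ, k = n) (h0 : 0 ≤ k) (h1 : k + 1 ≤ Γ.capacity C) (hkt : k ≤ t)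
    (ht : t ≤ Γ.capacity C) : f i C t - f i C k ≤ gain f i C k * (t - k) := by
  obtain ⟨n, rfl⟩ := hk
  lift n to ℕ using (by exact_mod_cast h0)
  simp only [Int.cast_natCast] at *
  rcases le_or_gt t (n + 1) with h | h
  · obtain ⟨a, b, hab⟩ := hf.affine i C n h1
    unfold gain
    rw [hab t ⟨hkt, h⟩, hab n ⟨le_rfl, by linarith⟩, hab (n + 1) ⟨by linarith, le_rfl⟩]
    apply le_of_eq; ring
  · have hL : 0 < t - n := by linarith
    have mt : t ∈ Set.Icc 0 (Γ.capacity C) := ⟨by linarith, ht⟩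
    have mk : (n : ℝ) ∈ Set.Icc 0 (Γ.capacity C) := ⟨h0, by linarith⟩
    have := (hf.concave i C).2 mt mk
      (show 0 ≤ 1 / (t - n) by positivity) (show 0 ≤ (t - n - 1) / (t - n) from
        div_nonneg (by linarith) hL.le) (by field_simp; ring)
    have e : (1 / (t - n)) • t + ((t - n - 1) / (t - n)) • (n : ℝ) = n + 1 := by
      simp only [smul_eq_mul]; field_simp; ring
    rw [e] at this
    simp only [smul_eq_mul] at this
    have h2 := mul_le_mul_of_nonneg_left this hL.le
    have e2 : (t - n) * (1 / (t - n) * f i C t + (t - n - 1) / (t - n) * f i C n) =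
      f i C t + (t - n - 1) * f i C n := by field_simp
    rw [e2] at h2
    unfold gain
    linarith

theorem sub_le_gain_left (hf : Γ.IsDecomposition f c) (i : N) {C : Γ.edges} {k t : ℝ}
    (hk : ∃ n : ℤ, k = n) (h0 : 1 ≤ k) (h1 : k ≤ Γ.capacity C) (ht : 0 ≤ t) (htk : t ≤ k) :
    f i C t - f i C k ≤ gain f i C (k - 1) * (t - k) := by
  rcases le_or_gt (k - 1) t with h | h
  · obtain ⟨n, hn⟩ := hk
    obtain ⟨m, hm⟩ : ∃ m : ℕ, k - 1 = m := by
      refine ⟨(n - 1).toNat, ?_⟩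
      have : 1 ≤ n := by rw [hn] at h0; exact_mod_cast h0
      have h2 : (((n - 1).toNat : ℤ) : ℝ) = ((n - 1 : ℤ) : ℝ) := by
        rw [Int.toNat_of_nonneg (by omega)]
      rw [hn]; push_cast at h2; rw [h2]
    obtain ⟨a, b, hab⟩ := hf.affine i C m (by linarith)
    unfold gain
    rw [hab t ⟨by linarith, by linarith⟩, hab k ⟨by linarith, by linarith⟩,
      hab (k - 1 + 1) ⟨by linarith, by linarith⟩, hab (k - 1) ⟨by linarith, by linarith⟩]
    apply le_of_eq; ring
  · have hL : 0 < k - t := by linarith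
    have mt : t ∈ Set.Icc 0 (Γ.capacity C) := ⟨ht, by linarith⟩
    have mk : k ∈ Set.Icc 0 (Γ.capacity C) := ⟨by linarith, h1⟩
    have := (hf.concave i C).2 mt mk
      (show 0 ≤ 1 / (k - t) by positivity) (show 0 ≤ (k - t - 1) / (k - t) from
        div_nonneg (by linarith) hL.le) (by field_simp; ring)
    have e : (1 / (k - t)) • t + ((k - t - 1) / (k - t)) • k = k - 1 := by
      simp only [smul_eq_mul]; field_simp; ring
    rw [e] at this
    simp only [smul_eq_mul] at this
    have h2 := mul_le_mul_of_nonneg_left this hL.le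
    have e2 : (k - t) * (1 / (k - t) * f i C t + (k - t - 1) / (k - t) * f i C k) =
      f i C t + (k - t - 1) * f i C k := by field_simp
    rw [e2] at h2
    unfold gain
    rw [sub_add_cancel]
    linarith

end IsDecomposition

/-- Weak Lagrangian duality: `μ` prices a unit of budget, and the edgewise bounds add up to `μ`
times the change of load. -/
theorem value_le_of_multiplier (f : N → Γ.edges → ℝ → ℝ) {i : N} {x y : Γ.edges → ℝ} (μ : ℝ)
    (h : ∀ C : Γ.edges, i ∈ C.1 → f i C (y C) - f i C (x C) ≤ μ * (y C - x C))
    (hμ : μ * (Γ.load y i - Γ.load x i) ≤ 0) : value f i y ≤ value f i x := by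
  have h1 := Finset.sum_le_sum fun C (hC : C ∈ Finset.univ.filter (fun C : Γ.edges => i ∈ C.1)) =>
    h C (Finset.mem_filter.1 hC).2
  rw [← Finset.mul_sum, Finset.sum_sub_distrib, Finset.sum_sub_distrib] at h1
  unfold value
  unfold load at hμ
  linarith

/-! ### Local optimality -/

/-- No change of one weight by one unit, and no shift of one unit between two edges, that respects
the bounds and the budget is profitable for agent `i`. -/
structure LocallyOptimal (f : N → Γ.edges → ℝ → ℝ) (i : N) (lo hi y : Γ.edges → ℝ) : Prop where
  gain_nonneg : ∀ C : Γ.edges, i ∈ C.1 → lo C < y C → 0 ≤ gain f i C (y C - 1)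
  gain_nonpos : ∀ C : Γ.edges, i ∈ C.1 → y C < hi C → Γ.load y i < Γ.budget i →
    gain f i C (y C) ≤ 0
  exchange : ∀ C C' : Γ.edges, i ∈ C.1 → i ∈ C'.1 → lo C < y C → y C' < hi C' →
    gain f i C' (y C') ≤ gain f i C (y C - 1)

section Optimality

variable {f : N → Γ.edges → ℝ → ℝ} {c : N → ℝ} {i : N} {lo hi y z : Γ.edges → ℝ}

theorem update_mem_options (hy : y ∈ Γ.options i lo hi) {C : Γ.edges} {t : ℝ}
    (hlo : lo C ≤ t) (hhi : t ≤ hi C) (hload : Γ.load (Function.update y C t) i ≤ Γ.budget i) :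
    Function.update y C t ∈ Γ.options i lo hi := by
  refine ⟨fun C' hC' => ?_, hload⟩
  by_cases h : C' = C
  · subst h; simpa using ⟨hlo, hhi⟩
  · simpa [Function.update_of_ne h] using hy.1 C' hC'

theorem IsIntegral.update (hy : Γ.IsIntegral y) {C : Γ.edges} {t : ℝ} (ht : ∃ k : ℤ, t = k) :
    Γ.IsIntegral (Function.update y C t) := by
  intro C'
  by_cases h : C' = C
  · subst h; simpa using ht
  · simpa [Function.update_of_ne h] using hy C'

theorem exists_int_add_one {t : ℝ} (ht : ∃ k : ℤ, t = k) : ∃ k : ℤ, t + 1 = k := by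
  obtain ⟨k, rfl⟩ := ht
  exact ⟨k + 1, by push_cast; rfl⟩

theorem exists_int_sub_one {t : ℝ} (ht : ∃ k : ℤ, t = k) : ∃ k : ℤ, t - 1 = k := by
  obtain ⟨k, rfl⟩ := ht
  exact ⟨k - 1, by push_cast; rfl⟩

/-- As bounds, budget and `y` are integral, any slack is at least one, so each unit move is itself
an integral option. -/
theorem locallyOptimal_of_forall_le (hf : Γ.IsDecomposition f c) (hint : Γ.IntegralConstraints)
    (hlo : Γ.IsIntegral lo) (hhi : Γ.IsIntegral hi) (hyi : Γ.IsIntegral y) (hlo0 : 0 ≤ lo)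
    (hhi_le : hi ≤ Γ.capacity) (hy : y ∈ Γ.options i lo hi)
    (hmax : ∀ y' ∈ Γ.options i lo hi, Γ.IsIntegral y' → value f i y' ≤ value f i y) :
    LocallyOptimal f i lo hi y := by
  constructor
  · intro C hC h
    have h1 := add_one_le_of_lt (hlo C) (hyi C) h
    have h2 := hmax (Function.update y C (y C - 1))
      (update_mem_options hy (by linarith) (by linarith [(hy.1 C hC).2])
        (by rw [load_update hC]; linarith [hy.2])) (hyi.update (exists_int_sub_one (hyi C)))
    rw [value_update f hC] at h2
    unfold gain
    rw [sub_add_cancel]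
    linarith
  · intro C hC h hb
    have h1 := add_one_le_of_lt (hyi C) (hhi C) h
    have h3 := add_one_le_of_lt (exists_int_load hyi i) (hint.2 i) hb
    have h2 := hmax (Function.update y C (y C + 1))
      (update_mem_options hy (by linarith [(hy.1 C hC).1]) h1
        (by rw [load_update hC]; linarith)) (hyi.update (exists_int_add_one (hyi C)))
    rw [value_update f hC] at h2
    unfold gain
    linarith
  · intro C C' hC hC' h h'
    have h1 := add_one_le_of_lt (hlo C) (hyi C) h
    have h1' := add_one_le_of_lt (hyi C') (hhi C') h'
    have hlC : 0 ≤ lo C := hlo0 C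
    -- With equal edges there is no exchange to compare with; the inequality is then concavity.
    by_cases hCC : C' = C
    · subst hCC
      exact hf.gain_anti i (by linarith) (by linarith) (h1'.trans (hhi_le _))
    · have hm := update_mem_options hy (C := C) (t := y C - 1) (by linarith)
        (by linarith [(hy.1 C hC).2]) (by rw [load_update hC]; linarith [hy.2])
      have h2 := hmax (Function.update (Function.update y C (y C - 1)) C' (y C' + 1))
        (update_mem_options hm (by linarith [(hy.1 C' hC').1]) h1'
          (by rw [load_update hC', load_update hC, Function.update_of_ne hCC]; linarith [hy.2]))
        ((hyi.update (exists_int_sub_one (hyi C))).update (exists_int_add_one (hyi C')))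
      rw [value_update f hC', value_update f hC, Function.update_of_ne hCC] at h2
      unfold gain
      rw [sub_add_cancel]
      linarith

/-- The multiplier is the largest positive gain still available below `hi`, or zero if there is
none. It separates the gains of units not taken from those of removable units. -/
theorem LocallyOptimal.value_le (hf : Γ.IsDecomposition f c) (hlo : Γ.IsIntegral lo)
    (hhi : Γ.IsIntegral hi) (hyi : Γ.IsIntegral y) (hlo0 : 0 ≤ lo) (hhi_le : hi ≤ Γ.capacity)
    (hy : y ∈ Γ.options i lo hi) (h : LocallyOptimal f i lo hi y) {y' : Γ.edges → ℝ}
    (hy' : y' ∈ Γ.options i lo hi) : value f i y' ≤ value f i y := by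
  classical
  have key : ∀ μ : ℝ,
      (∀ C : Γ.edges, i ∈ C.1 → lo C < y C → μ ≤ gain f i C (y C - 1)) →
      (∀ C : Γ.edges, i ∈ C.1 → y C < hi C → gain f i C (y C) ≤ μ) →
      μ * (Γ.load y' i - Γ.load y i) ≤ 0 → value f i y' ≤ value f i y := by
    intro μ hl hr hμ
    refine value_le_of_multiplier f μ (fun C hC => ?_) hμ
    have hlC : 0 ≤ lo C := hlo0 C
    have hcC := hhi_le C
    obtain ⟨hy1, hy2⟩ := hy.1 C hC
    obtain ⟨hy1', hy2'⟩ := hy'.1 C hC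
    rcases lt_trichotomy (y' C) (y C) with hlt | heq | hgt
    · have h1 := add_one_le_of_lt (hlo C) (hyi C) (hy1'.trans_lt hlt)
      have h2 := hf.sub_le_gain_left i (hyi C) (by linarith) (by linarith) (by linarith) hlt.le
      exact h2.trans (mul_le_mul_of_nonpos_right (hl C hC (hy1'.trans_lt hlt)) (by linarith))
    · simp [heq]
    · have h1 := add_one_le_of_lt (hyi C) (hhi C) (hgt.trans_le hy2')
      have h2 := hf.sub_le_gain_right i (hyi C) (by linarith) (by linarith) hgt.le (by linarith)
      exact h2.trans (mul_le_mul_of_nonneg_right (hr C hC (hgt.trans_le hy2')) (by linarith))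
  let S : Finset Γ.edges :=
    Finset.univ.filter fun C => i ∈ C.1 ∧ y C < hi C ∧ 0 < gain f i C (y C)
  rcases S.eq_empty_or_nonempty with hS | hS
  · refine key 0 h.gain_nonneg (fun C hC hlt => ?_) (by simp)
    by_contra hpos
    have : C ∈ S := by simp [S, hC, hlt, not_le.1 hpos]
    simp [hS] at this
  · obtain ⟨C₀, hC₀, hmax⟩ := S.exists_max_image (fun C => gain f i C (y C)) hS
    obtain ⟨hi₀, hlt₀, hpos₀⟩ := (Finset.mem_filter.1 hC₀).2
    -- A profitable unit with room below `hi` is left over, so the budget must be what forbids it;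
    -- then no option has a larger load.
    have htight : Γ.load y i = Γ.budget i := by
      refine le_antisymm hy.2 (not_lt.1 fun hb => ?_)
      exact (h.gain_nonpos C₀ hi₀ hlt₀ hb).not_gt hpos₀
    refine key _ (fun C hC hlt => h.exchange C C₀ hC hi₀ hlt hlt₀) (fun C hC hlt => ?_) ?_
    · by_cases hp : 0 < gain f i C (y C)
      · exact hmax C (by simp [S, hC, hlt, hp])
      · exact (not_lt.1 hp).trans hpos₀.le
    · exact mul_nonpos_of_nonneg_of_nonpos hpos₀.le (by rw [htight]; linarith [hy'.2])

theorem payoff_splice (hf : Γ.IsDecomposition f c) (hz : z ∈ Γ.box) {S : Finset N} (hi : i ∈ S)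
    (hy : ∀ C : Γ.edges, (∃ j ∈ S, j ∈ C.1) → y C ∈ Set.Icc 0 (Γ.capacity C)) :
    Γ.payoff (Γ.splice S y z) i = value f i y + c i := by
  rw [hf.payoff_eq i]
  · congr 1
    refine value_congr f fun C hC => ?_
    simp only [splice]
    rw [if_pos ⟨i, hi, hC⟩]
  · intro C
    unfold splice
    split_ifs with h
    · exact hy C h
    · exact hz C

theorem mem_argmax_iff (hf : Γ.IsDecomposition f c) (hz : z ∈ Γ.box) (hlo0 : 0 ≤ lo)
    (hhi_le : hi ≤ Γ.capacity) :
    y ∈ Γ.argmax i lo hi z ↔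
      y ∈ Γ.options i lo hi ∧ ∀ y' ∈ Γ.options i lo hi, value f i y' ≤ value f i y := by
  have key : ∀ y' ∈ Γ.options i lo hi,
      Γ.payoff (Γ.splice {i} y' z) i = value f i y' + c i := fun y' hy' =>
    payoff_splice hf hz (Finset.mem_singleton_self i) fun C hC => by
      have hC' : i ∈ C.1 := by simpa using hC
      exact ⟨(hlo0 C).trans (hy'.1 C hC').1, (hy'.1 C hC').2.trans (hhi_le C)⟩
  refine and_congr_right fun hy => forall₂_congr fun y' hy' => ?_
  rw [key y hy, key y' hy', add_le_add_iff_right]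

theorem locallyOptimal_of_mem_argmax (hf : Γ.IsDecomposition f c) (hint : Γ.IntegralConstraints)
    (hlo : Γ.IsIntegral lo) (hhi : Γ.IsIntegral hi) (hyi : Γ.IsIntegral y) (hlo0 : 0 ≤ lo)
    (hhi_le : hi ≤ Γ.capacity) (hz : z ∈ Γ.box) (hy : y ∈ Γ.argmax i lo hi z) :
    LocallyOptimal f i lo hi y := by
  rw [mem_argmax_iff hf hz hlo0 hhi_le] at hy
  exact locallyOptimal_of_forall_le hf hint hlo hhi hyi hlo0 hhi_le hy.1 fun y' h _ => hy.2 y' h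

/-! ### Existence of integral choices -/

/-- The best of the finitely many integral options is locally optimal, hence optimal among the real
ones too. -/
theorem exists_integral_mem_argmax (hf : Γ.IsDecomposition f c) (hint : Γ.IntegralConstraints)
    (hlo : Γ.IsIntegral lo) (hhi : Γ.IsIntegral hi) (hlo0 : 0 ≤ lo) (hlohi : lo ≤ hi)
    (hhi_le : hi ≤ Γ.capacity) (hz : z ∈ Γ.box) (hload : Γ.load lo i ≤ Γ.budget i) :
    ∃ y ∈ Γ.argmax i lo hi z, Γ.IsIntegral y := by
  classical
  choose l hl using hlo
  choose h hh using hhi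
  let S : Finset (Γ.edges → ℤ) :=
    (Fintype.piFinset fun C => Finset.Icc (l C) (h C)).filter
      fun k => Γ.load (fun C => (k C : ℝ)) i ≤ Γ.budget i
  have hS : S.Nonempty := by
    refine ⟨l, Finset.mem_filter.2 ⟨?_, ?_⟩⟩
    · refine Fintype.mem_piFinset.2 fun C => Finset.mem_Icc.2 ⟨le_rfl, ?_⟩
      have : lo C ≤ hi C := hlohi C
      rw [hl, hh] at this
      exact_mod_cast this
    · rwa [← show lo = fun C => (l C : ℝ) from funext hl]
  obtain ⟨k, hk, hmax⟩ := S.exists_max_image (fun k => value f i fun C => (k C : ℝ)) hS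
  obtain ⟨hk1, hk2⟩ := Finset.mem_filter.1 hk
  have hkopt : (fun C => (k C : ℝ)) ∈ Γ.options i lo hi := by
    refine ⟨fun C _ => ?_, hk2⟩
    have := Finset.mem_Icc.1 (Fintype.mem_piFinset.1 hk1 C)
    rw [hl, hh]
    exact ⟨Int.cast_le.2 this.1, Int.cast_le.2 this.2⟩
  have hkint : Γ.IsIntegral fun C => (k C : ℝ) := fun C => ⟨k C, rfl⟩
  have hloc : LocallyOptimal f i lo hi fun C => (k C : ℝ) := by
    refine locallyOptimal_of_forall_le hf hint (fun C => ⟨l C, hl C⟩) (fun C => ⟨h C, hh C⟩) hkint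
      hlo0 hhi_le hkopt fun y' hy' hy'i => ?_
    choose m hm using hy'i
    -- Options leave foreign edges free; resetting these to `l` puts the vector into the finite box.
    let m' : Γ.edges → ℤ := fun C => if i ∈ C.1 then m C else l C
    have hcongr : ∀ C : Γ.edges, i ∈ C.1 → y' C = (m' C : ℝ) := fun C hC => by
      simp [m', hC, hm]
    rw [value_congr f hcongr]
    refine hmax m' (Finset.mem_filter.2 ⟨Fintype.mem_piFinset.2 fun C => ?_, ?_⟩)
    · by_cases hC : i ∈ C.1
      · have := hy'.1 C hC
        rw [hl, hh, hm] at this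
        simp only [m', if_pos hC, Finset.mem_Icc]
        exact ⟨by exact_mod_cast this.1, by exact_mod_cast this.2⟩
      · have : lo C ≤ hi C := hlohi C
        rw [hl, hh] at this
        simp only [m', if_neg hC, Finset.mem_Icc]
        exact ⟨le_rfl, by exact_mod_cast this⟩
    · rw [← load_congr hcongr]
      exact hy'.2
  refine ⟨_, (mem_argmax_iff hf hz hlo0 hhi_le).2 ⟨hkopt, fun y' hy' => ?_⟩, hkint⟩
  exact hloc.value_le hf (fun C => ⟨l C, hl C⟩) (fun C => ⟨h C, hh C⟩) hkint hlo0 hhi_le hkopt hy'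

/-- The vectors that a tie rule may prefer, `0` and `z`, are themselves integral, so tie rule and
integrality never conflict. -/
theorem exists_isChoice (hf : Γ.IsDecomposition f c) (hint : Γ.IntegralConstraints)
    (hlo : Γ.IsIntegral lo) (hhi : Γ.IsIntegral hi) (hlo0 : 0 ≤ lo) (hlohi : lo ≤ hi)
    (hhi_le : hi ≤ Γ.capacity) (hz : z ∈ Γ.box) (hzi : Γ.IsIntegral z)
    (hload : Γ.load lo i ≤ Γ.budget i) (τ : TieRule) : ∃ y, Γ.IsChoice τ i lo hi z y := by
  obtain ⟨y, hy, hyi⟩ :=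
    exists_integral_mem_argmax hf hint hlo hhi hlo0 hlohi hhi_le hz hload
  cases τ with
  | arbitrary => exact ⟨y, hy, fun C _ => hyi C, trivial⟩
  | preferZero =>
    by_cases h0 : (0 : Γ.edges → ℝ) ∈ Γ.argmax i lo hi z
    · exact ⟨0, h0, fun C _ => ⟨0, by simp⟩, fun _ C _ => rfl⟩
    · exact ⟨y, hy, fun C _ => hyi C, fun h => absurd h h0⟩
  | preferCurrent =>
    by_cases h0 : z ∈ Γ.argmax i lo hi z
    · exact ⟨z, h0, fun C _ => hzi C, fun _ C _ => rfl⟩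
    · exact ⟨y, hy, fun C _ => hyi C, fun h => absurd h h0⟩

theorem IsChoice.congr {τ : TieRule} {y' : Γ.edges → ℝ} (hy : Γ.IsChoice τ i lo hi z y)
    (h : ∀ C : Γ.edges, i ∈ C.1 → y' C = y C) : Γ.IsChoice τ i lo hi z y' := by
  obtain ⟨⟨⟨hb, hl⟩, hmax⟩, hyi, hob⟩ := hy
  have hs : Γ.splice {i} y' z = Γ.splice {i} y z := by
    funext C
    by_cases hC : i ∈ C.1 <;> simp [splice, hC, h]
  refine ⟨⟨⟨fun C hC => ?_, ?_⟩, fun y'' hy'' => ?_⟩, fun C hC => ?_, ?_⟩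
  · rw [h C hC]; exact hb C hC
  · rwa [load_congr h]
  · rw [hs]; exact hmax y'' hy''
  · rw [h C hC]; exact hyi C hC
  · cases τ with
    | arbitrary => trivial
    | preferZero => exact fun h0 C hC => (h C hC).trans (hob h0 C hC)
    | preferCurrent => exact fun h0 C hC => (h C hC).trans (hob h0 C hC)

/-- Choices of agents no two of which share an edge can be combined into one network. -/
theorem exists_forall_isChoice {τ : TieRule} {W : Set N}
    (hW : ∀ C : Γ.edges, ∀ i ∈ W, ∀ j ∈ W, i ∈ C.1 → j ∈ C.1 → i = j)
    (h : ∀ i ∈ W, ∃ y, Γ.IsChoice τ i lo hi z y) : ∃ y, ∀ i ∈ W, Γ.IsChoice τ i lo hi z y := by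
  classical
  choose g hg using h
  refine ⟨fun C => if hC : ∃ i, i ∈ W ∧ i ∈ C.1 then g hC.choose hC.choose_spec.1 C else 0,
    fun i hi => (hg i hi).congr fun C hC => ?_⟩
  have hex : ∃ i, i ∈ W ∧ i ∈ C.1 := ⟨i, hi, hC⟩
  have he : hex.choose = i := hW C _ hex.choose_spec.1 i hi hex.choose_spec.2 hC
  simp only [dif_pos hex]
  congr!

end Optimality

/-! ### Saturated edges -/

/-- Agent `i` does not want to raise the weight of `C` beyond `t`, even if it may lower the weights
of other edges: the next unit is not worth having, or the budget is exhausted and no unit of the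
network `x` is worth less. -/
def Saturated (f : N → Γ.edges → ℝ → ℝ) (i : N) (C : Γ.edges) (x : Γ.edges → ℝ) (t : ℝ) : Prop :=
  gain f i C t ≤ 0 ∨ (Γ.load x i = Γ.budget i ∧
    ∀ C' : Γ.edges, i ∈ C'.1 → 0 < x C' → gain f i C t ≤ gain f i C' (x C' - 1))

section Stability

variable {f : N → Γ.edges → ℝ → ℝ} {c : N → ℝ} {i : N} {x y : Γ.edges → ℝ}

theorem one_le_of_pos {t : ℝ} (ht : ∃ k : ℤ, t = k) (h : 0 < t) : 1 ≤ t := by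
  simpa using add_one_le_of_lt ⟨0, by simp⟩ ht h

theorem sub_le_mul_of_le (hf : Γ.IsDecomposition f c) {C : Γ.edges} {μ t : ℝ}
    (hxi : Γ.IsIntegral x) (hx : x C ≤ Γ.capacity C) (ht0 : 0 ≤ t) (ht : t ≤ x C)
    (hμ : 0 < x C → μ ≤ gain f i C (x C - 1)) :
    f i C t - f i C (x C) ≤ μ * (t - x C) := by
  rcases ht.lt_or_eq with hlt | rfl
  · have hpos := ht0.trans_lt hlt
    exact (hf.sub_le_gain_left i (hxi C) (one_le_of_pos (hxi C) hpos) hx ht0 ht).trans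
      (mul_le_mul_of_nonpos_right (hμ hpos) (by linarith))
  · simp

theorem value_le_of_le (hf : Γ.IsDecomposition f c) (hxi : Γ.IsIntegral x)
    (hx : x ≤ Γ.capacity)
    (hpos : ∀ C : Γ.edges, i ∈ C.1 → 0 < x C → 0 ≤ gain f i C (x C - 1))
    (hy : ∀ C : Γ.edges, i ∈ C.1 → 0 ≤ y C ∧ y C ≤ x C) : value f i y ≤ value f i x :=
  value_le_of_multiplier f 0 (fun C hC =>
    sub_le_mul_of_le hf hxi (hx C) (hy C hC).1 (hy C hC).2 (hpos C hC)) (by simp)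

/-- The multiplier is the gain of the next unit of `C` if it is positive, and zero otherwise;
saturation says that no unit held elsewhere is worth less. -/
theorem Saturated.value_le (hf : Γ.IsDecomposition f c) (hxi : Γ.IsIntegral x)
    (hx0 : 0 ≤ x) (hx : x ≤ Γ.capacity) {C : Γ.edges}
    (hpos : ∀ C : Γ.edges, i ∈ C.1 → 0 < x C → 0 ≤ gain f i C (x C - 1))
    (hlt : x C + 1 ≤ Γ.capacity C) (hsat : Saturated f i C x (x C))
    (hyC : x C ≤ y C) (hyC' : y C ≤ Γ.capacity C)
    (hy : ∀ C' : Γ.edges, C' ≠ C → i ∈ C'.1 → 0 ≤ y C' ∧ y C' ≤ x C')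
    (hload : Γ.load y i ≤ Γ.budget i) : value f i y ≤ value f i x := by
  have key : ∀ μ : ℝ, gain f i C (x C) ≤ μ →
      (∀ C' : Γ.edges, i ∈ C'.1 → 0 < x C' → μ ≤ gain f i C' (x C' - 1)) →
      μ * (Γ.load y i - Γ.load x i) ≤ 0 → value f i y ≤ value f i x := by
    intro μ h1 h2 h3
    refine value_le_of_multiplier f μ (fun C' hC' => ?_) h3
    by_cases h : C' = C
    · subst h
      exact (hf.sub_le_gain_right i (hxi _) (hx0 _) hlt hyC hyC').trans
        (mul_le_mul_of_nonneg_right h1 (by linarith))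
    · exact sub_le_mul_of_le hf hxi (hx C') (hy C' h hC').1 (hy C' h hC').2 (h2 C' hC')
  rcases le_or_gt (gain f i C (x C)) 0 with h | h
  · exact key 0 h hpos (by simp)
  · obtain ⟨h1, h2⟩ := hsat.resolve_left h.not_ge
    exact key _ le_rfl h2 (mul_nonpos_of_nonneg_of_nonpos h.le (by linarith))

/-- A saturated edge stays saturated when the agent chooses from a larger set of options. -/
theorem Saturated.of_locallyOptimal (hf : Γ.IsDecomposition f c) {C : Γ.edges} {t : ℝ}
    {p r : Γ.edges → ℝ} (hsat : Saturated f i C x t) (hxi : Γ.IsIntegral x)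
    (hri : Γ.IsIntegral r) (hr0 : 0 ≤ r) (hxp : x ≤ p) (hp : p ≤ Γ.capacity)
    (hrb : Γ.load r i ≤ Γ.budget i) (hr : LocallyOptimal f i 0 p r) :
    Saturated f i C r t := by
  rcases hsat with h | ⟨hb, hex⟩
  · exact Or.inl h
  rcases le_or_gt (gain f i C t) 0 with h | hpos
  · exact Or.inl h
  -- The unit of `x` lost on a cut edge was worth at least the next unit of `C`, and concavity
  -- carries this down to `r C'`.
  have hlow : ∀ C' : Γ.edges, i ∈ C'.1 → r C' < x C' → gain f i C t ≤ gain f i C' (r C') := by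
    intro C' hC' hlt
    have h0 : 0 ≤ r C' := hr0 C'
    have h1 := add_one_le_of_lt (hri C') (hxi C') hlt
    have h2 := hxp C'
    have h3 := hp C'
    exact (hex C' hC' (by linarith)).trans (hf.gain_anti i h0 (by linarith) (by linarith))
  -- With budget to spare, some edge would be below `x`, and restoring a unit there would be
  -- profitable and allowed, since `x ≤ p`.
  have htight : Γ.load r i = Γ.budget i := by
    refine le_antisymm hrb (not_lt.1 fun hlt => ?_)
    obtain ⟨C', hC', hlt'⟩ := Finset.exists_lt_of_sum_lt (hlt.trans_eq hb.symm)
    have hC' := (Finset.mem_filter.1 hC').2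
    have h1 := hr.gain_nonpos C' hC' (hlt'.trans_le (hxp C')) hlt
    linarith [hlow C' hC' hlt']
  refine Or.inr ⟨htight, fun C' hC' hrpos => ?_⟩
  rcases le_or_gt (r C') (x C') with h | h
  · have h1 := one_le_of_pos (hri C') hrpos
    have h2 := hxp C'
    have h3 := hp C'
    exact (hex C' hC' (hrpos.trans_le h)).trans
      (hf.gain_anti i (by linarith) (by linarith) (by linarith))
  · obtain ⟨C'', hC'', hlt⟩ : ∃ C'' : Γ.edges, i ∈ C''.1 ∧ r C'' < x C'' := by
      by_contra! hall
      have : Γ.load x i < Γ.load r i :=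
        Finset.sum_lt_sum (fun D hD => hall D (Finset.mem_filter.1 hD).2)
          ⟨C', by simp [hC'], h⟩
      linarith
    exact (hlow C'' hC'' hlt).trans
      (hr.exchange C' C'' hC' hC'' hrpos (hlt.trans_le (hxp C'')))

end Stability

/-! ### The invariant of the algorithm -/

/-- What holds in every state that the algorithm can reach. -/
structure GDAInvariant (f : N → Γ.edges → ℝ → ℝ) (U V : Set N) (s : Γ.GDAState) : Prop where
  weight_int : Γ.IsIntegral s.weight
  cap_int : Γ.IsIntegral s.cap
  weight_nonneg : 0 ≤ s.weight
  weight_le : s.weight ≤ s.cap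
  cap_le : s.cap ≤ Γ.capacity
  load_le : ∀ i, Γ.load s.weight i ≤ Γ.budget i
  gain_nonneg : ∀ i, ∀ C : Γ.edges, i ∈ C.1 → 0 < s.weight C →
    0 ≤ gain f i C (s.weight C - 1)
  exchange : ∀ i ∈ U, ∀ C C' : Γ.edges, i ∈ C.1 → i ∈ C'.1 → 0 < s.weight C →
    s.weight C' < s.cap C' → gain f i C' (s.weight C') ≤ gain f i C (s.weight C - 1)
  saturated : ∀ j ∈ V, ∀ C : Γ.edges, j ∈ C.1 → s.cap C < Γ.capacity C →
    Saturated f j C s.weight (s.cap C)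

theorem IsBipartition.mem_or_mem {U V : Set N} (h : Γ.IsBipartition U V) (i : N) :
    i ∈ U ∨ i ∈ V := by
  have : i ∈ U ∪ V := by rw [h.2.1]; trivial
  exact this

theorem IsBipartition.exists_mem_left {U V : Set N} (h : Γ.IsBipartition U V) (C : Γ.edges) :
    ∃ i ∈ U, i ∈ C.1 := by
  obtain ⟨i, hi, j, -, hC⟩ := h.2.2 C.1 C.2
  exact ⟨i, hi, by simp [hC]⟩

theorem IsBipartition.symm {U V : Set N} (h : Γ.IsBipartition U V) : Γ.IsBipartition V U := by
  refine ⟨h.1.symm, by rw [Set.union_comm, h.2.1], fun C hC => ?_⟩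
  obtain ⟨i, hi, j, hj, rfl⟩ := h.2.2 C hC
  exact ⟨j, hj, i, hi, Finset.pair_comm i j⟩

theorem IsBipartition.eq_of_mem_left {U V : Set N} (h : Γ.IsBipartition U V) (C : Γ.edges) :
    ∀ i ∈ U, ∀ j ∈ U, i ∈ C.1 → j ∈ C.1 → i = j := by
  obtain ⟨k, hk, l, hl, hC⟩ := h.2.2 C.1 C.2
  have key : ∀ i ∈ U, i ∈ C.1 → i = k := fun i hi hiC => by
    rw [hC, Finset.mem_insert, Finset.mem_singleton] at hiC
    refine hiC.resolve_right fun e => Set.disjoint_left.1 h.1 hi (e ▸ hl)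
  exact fun i hi j hj hiC hjC => (key i hi hiC).trans (key j hj hjC).symm

section Algorithm

variable {f : N → Γ.edges → ℝ → ℝ} {c : N → ℝ} {U V : Set N} {τ τU τV : TieRule}
  {s : Γ.GDAState} {p r : Γ.edges → ℝ}

theorem IsProposal.isIntegral (hbip : Γ.IsBipartition U V) (hp : Γ.IsProposal τ U s p) :
    Γ.IsIntegral p := fun C => by
  obtain ⟨i, hi, hC⟩ := hbip.exists_mem_left C
  exact (hp i hi).2.1 C hC

theorem IsProposal.bounds (hbip : Γ.IsBipartition U V) (hp : Γ.IsProposal τ U s p) (C : Γ.edges) :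
    s.weight C ≤ p C ∧ p C ≤ s.cap C := by
  obtain ⟨i, hi, hC⟩ := hbip.exists_mem_left C
  exact (hp i hi).1.1.1 C hC

theorem IsDisposal.isIntegral (hbip : Γ.IsBipartition U V) (hr : Γ.IsDisposal τ V p r) :
    Γ.IsIntegral r := fun C => by
  obtain ⟨i, hi, hC⟩ := hbip.symm.exists_mem_left C
  exact (hr i hi).2.1 C hC

theorem IsDisposal.bounds (hbip : Γ.IsBipartition U V) (hr : Γ.IsDisposal τ V p r) (C : Γ.edges) :
    0 ≤ r C ∧ r C ≤ p C := by
  obtain ⟨i, hi, hC⟩ := hbip.symm.exists_mem_left C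
  exact (hr i hi).1.1.1 C hC

namespace GDAInvariant

theorem weight_mem_box (h : GDAInvariant f U V s) : s.weight ∈ Γ.box := fun C =>
  ⟨h.weight_nonneg C, (h.weight_le C).trans (h.cap_le C)⟩

theorem proposal_mem_box (h : GDAInvariant f U V s) (hbip : Γ.IsBipartition U V)
    (hp : Γ.IsProposal τ U s p) : p ∈ Γ.box := fun C =>
  ⟨(h.weight_nonneg C).trans (hp.bounds hbip C).1, (hp.bounds hbip C).2.trans (h.cap_le C)⟩

theorem init (hint : Γ.IntegralConstraints) : GDAInvariant f U V Γ.gdaInit where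
  weight_int := fun _ => ⟨0, by simp [gdaInit]⟩
  cap_int := hint.1
  weight_nonneg := le_rfl
  weight_le := Γ.capacity_nonneg
  cap_le := le_rfl
  load_le := zero_mem_feasible.2
  gain_nonneg := fun _ _ _ h => absurd h (lt_irrefl _)
  exchange := fun _ _ _ _ _ _ h => absurd h (lt_irrefl _)
  saturated := fun _ _ _ _ h => absurd h (lt_irrefl _)

theorem exists_isProposal (h : GDAInvariant f U V s) (hf : Γ.IsDecomposition f c)
    (hint : Γ.IntegralConstraints) (hbip : Γ.IsBipartition U V) (τ : TieRule) :
    ∃ p, Γ.IsProposal τ U s p :=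
  exists_forall_isChoice hbip.eq_of_mem_left fun i _ =>
    exists_isChoice hf hint h.weight_int h.cap_int h.weight_nonneg h.weight_le h.cap_le
      h.weight_mem_box h.weight_int (h.load_le i) τ

theorem exists_isDisposal (h : GDAInvariant f U V s) (hf : Γ.IsDecomposition f c)
    (hint : Γ.IntegralConstraints) (hbip : Γ.IsBipartition U V) (hp : Γ.IsProposal τU U s p)
    (τ : TieRule) : ∃ r, Γ.IsDisposal τ V p r := by
  have hpb := h.proposal_mem_box hbip hp
  exact exists_forall_isChoice hbip.symm.eq_of_mem_left fun j _ =>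
    exists_isChoice hf hint (fun _ => ⟨0, by simp⟩) (hp.isIntegral hbip) le_rfl
      (fun C => (hpb C).1) (fun C => (hpb C).2) hpb (hp.isIntegral hbip)
      (zero_mem_feasible.2 j) τ

theorem locallyOptimal_proposal (h : GDAInvariant f U V s) (hf : Γ.IsDecomposition f c)
    (hint : Γ.IntegralConstraints) (hbip : Γ.IsBipartition U V) (hp : Γ.IsProposal τ U s p)
    {i : N} (hi : i ∈ U) : LocallyOptimal f i s.weight s.cap p :=
  locallyOptimal_of_mem_argmax hf hint h.weight_int h.cap_int (hp.isIntegral hbip)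
    h.weight_nonneg h.cap_le h.weight_mem_box (hp i hi).1

/-- A proposal remains locally optimal when the proposing agents may also lower weights. -/
theorem locallyOptimal_zero_proposal (h : GDAInvariant f U V s) (hf : Γ.IsDecomposition f c)
    (hint : Γ.IntegralConstraints) (hbip : Γ.IsBipartition U V) (hp : Γ.IsProposal τ U s p)
    {i : N} (hi : i ∈ U) : LocallyOptimal f i 0 s.cap p := by
  have hloc := h.locallyOptimal_proposal hf hint hbip hp hi
  refine ⟨fun C hC hpos => ?_, hloc.gain_nonpos, fun C C' hC hC' hpos hlt => ?_⟩
  -- A raised edge is covered by the optimality of the proposal, an unchanged one by the invariant.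
  · rcases (hp.bounds hbip C).1.lt_or_eq with hlt | heq
    · exact hloc.gain_nonneg C hC hlt
    · rw [← heq] at hpos ⊢
      exact h.gain_nonneg i C hC hpos
  · rcases (hp.bounds hbip C).1.lt_or_eq with hlt' | heq
    · exact hloc.exchange C C' hC hC' hlt' hlt
    · rw [← heq] at hpos ⊢
      have hle := (hp.bounds hbip C').1
      have h1 := add_one_le_of_lt (hp.isIntegral hbip C') (h.cap_int C') hlt
      exact (hf.gain_anti i (h.weight_nonneg C') hle (h1.trans (h.cap_le C'))).trans
        (h.exchange i hi C C' hC hC' hpos (hle.trans_lt hlt))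

theorem locallyOptimal_disposal (h : GDAInvariant f U V s) (hf : Γ.IsDecomposition f c)
    (hint : Γ.IntegralConstraints) (hbip : Γ.IsBipartition U V) (hp : Γ.IsProposal τU U s p)
    (hr : Γ.IsDisposal τV V p r) {j : N} (hj : j ∈ V) : LocallyOptimal f j 0 p r :=
  have hpb := h.proposal_mem_box hbip hp
  locallyOptimal_of_mem_argmax hf hint (fun _ => ⟨0, by simp⟩) (hp.isIntegral hbip)
    (hr.isIntegral hbip) le_rfl (fun C => (hpb C).2) hpb (hr j hj).1

theorem next (h : GDAInvariant f U V s) (hf : Γ.IsDecomposition f c)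
    (hint : Γ.IntegralConstraints) (hbip : Γ.IsBipartition U V) (hp : Γ.IsProposal τU U s p)
    (hr : Γ.IsDisposal τV V p r) : GDAInvariant f U V (Γ.gdaNext s p r) := by
  have hpb := h.proposal_mem_box hbip hp
  have hri := hr.isIntegral hbip
  have hU := fun i hi => h.locallyOptimal_zero_proposal hf hint hbip hp (i := i) hi
  have hV := fun j hj => h.locallyOptimal_disposal hf hint hbip hp hr (j := j) hj
  have hrp := fun C => (hr.bounds hbip C).2
  have hr0 : 0 ≤ r := fun C => (hr.bounds hbip C).1
  have hload : ∀ i, Γ.load r i ≤ Γ.budget i := fun i => by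
    rcases hbip.mem_or_mem i with hi | hi
    · exact (load_mono fun C _ => hrp C).trans (hp i hi).1.1.2
    · exact (hr i hi).1.1.2
  -- Cutting an edge only increases the gain of its last remaining unit, so what the proposal
  -- satisfies survives the disposal.
  have hlower : ∀ i, ∀ C, 0 < r C → gain f i C (p C - 1) ≤ gain f i C (r C - 1) :=
    fun i C hpos => hf.gain_anti i (by linarith [one_le_of_pos (hri C) hpos])
      (by linarith [hrp C]) (by linarith [(hpb C).2])
  refine ⟨hri, fun C => ?_, hr0, fun C => ?_, fun C => ?_, hload, fun i C hC hpos => ?_,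
    fun i hi C C' hC hC' hpos hlt => ?_, fun j hj C hC hlt => ?_⟩
  · simp only [gdaNext]
    split_ifs
    · exact hri C
    · exact h.cap_int C
  · simp only [gdaNext]
    split_ifs
    · exact le_rfl
    · exact (hrp C).trans (hp.bounds hbip C).2
  · simp only [gdaNext]
    split_ifs
    · exact (hrp C).trans (hpb C).2
    · exact h.cap_le C
  · rcases hbip.mem_or_mem i with hi | hi
    · exact ((hU i hi).gain_nonneg C hC (hpos.trans_le (hrp C))).trans (hlower i C hpos)
    · exact (hV i hi).gain_nonneg C hC hpos
  · simp only [gdaNext] at hlt hpos ⊢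
    split_ifs at hlt with hred
    -- A cut edge has its new weight as capacity and leaves no room to raise.
    · exact absurd hlt (lt_irrefl _)
    · have heq : r C' = p C' := le_antisymm (hrp C') (not_lt.1 hred)
      rw [heq] at hlt ⊢
      exact ((hU i hi).exchange C C' hC hC' (hpos.trans_le (hrp C)) hlt).trans (hlower i C hpos)
  · simp only [gdaNext] at hlt ⊢
    split_ifs at hlt ⊢ with hred
    -- The disposal stopped strictly below `p C`, so its local optimality conditions on `C` are
    -- exactly saturation at `r C`.
    · rcases (hload j).lt_or_eq with hb | hb
      · exact Or.inl ((hV j hj).gain_nonpos C hC hred hb)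
      · exact Or.inr ⟨hb, fun C' hC' hpos => (hV j hj).exchange C' C hC' hC hpos hred⟩
    · exact (h.saturated j hj C hC hlt).of_locallyOptimal hf h.weight_int hri hr0
        (fun C => (hp.bounds hbip C).1) (fun C => (hpb C).2) (hload j) (hV j hj)

/-! ### Termination and stability of the result -/

/-- The proposal raises some weight by at least one, which closes that much of the gap. The disposal
never reopens it: an uncut edge keeps its proposed weight, and a cut one ends with gap zero. -/
theorem sum_gap_next (h : GDAInvariant f U V s) (hbip : Γ.IsBipartition U V)
    (hp : Γ.IsProposal τU U s p) (hne : p ≠ s.weight) (hr : Γ.IsDisposal τV V p r) :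
    ∑ C, ((Γ.gdaNext s p r).cap C - (Γ.gdaNext s p r).weight C) + 1 ≤
      ∑ C, (s.cap C - s.weight C) := by
  have hle : ∀ C, (Γ.gdaNext s p r).cap C - (Γ.gdaNext s p r).weight C ≤ s.cap C - p C := by
    intro C
    have h1 := (hp.bounds hbip C).2
    have h2 := (hr.bounds hbip C).2
    simp only [gdaNext]
    split_ifs with hred <;> linarith
  obtain ⟨C₀, hC₀⟩ : ∃ C, p C ≠ s.weight C := by
    by_contra! hall
    exact hne (funext hall)
  have hlt := add_one_le_of_lt (h.weight_int C₀) (hp.isIntegral hbip C₀)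
    (lt_of_le_of_ne (hp.bounds hbip C₀).1 hC₀.symm)
  rw [← Finset.add_sum_erase _ _ (Finset.mem_univ C₀),
    ← Finset.add_sum_erase _ (fun C => s.cap C - s.weight C) (Finset.mem_univ C₀)]
  have hsum := Finset.sum_le_sum fun C (_ : C ∈ Finset.univ.erase C₀) =>
    (hle C).trans (sub_le_sub_left (hp.bounds hbip C).1 (s.cap C))
  linarith [hle C₀]

theorem fullyStable (h : GDAInvariant f U V s) (hf : Γ.IsDecomposition f c)
    (hint : Γ.IntegralConstraints) (hbip : Γ.IsBipartition U V)
    (hp : Γ.IsProposal τ U s s.weight) : Γ.FullyStable s.weight := by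
  have hbox := h.weight_mem_box
  have hcap : s.weight ≤ Γ.capacity := fun C => (hbox C).2
  have hpay : ∀ i, Γ.payoff s.weight i = value f i s.weight + c i := fun i =>
    hf.payoff_eq i _ hbox
  refine ⟨⟨hbox, h.load_le⟩, fun i y hy => ?_, fun C y hyb hyC hy hgain => ?_⟩
  · rw [hpay, payoff_splice hf hbox (Finset.mem_singleton_self i) fun C hC => ?_]
    · exact add_le_add_left (value_le_of_le hf h.weight_int hcap (h.gain_nonneg i) hy) _
    · have hC : i ∈ C.1 := by simpa using hC
      exact ⟨(hy C hC).1, (hy C hC).2.trans (hcap C)⟩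
  · by_contra! hload
    have hval : ∀ i ∈ C.1, ¬ value f i y ≤ value f i s.weight := fun i hi hle => by
      have := hgain i hi
      rw [hpay, payoff_splice hf hbox hi hyb] at this
      linarith
    have hy' : ∀ i ∈ C.1, ∀ C' : Γ.edges, C' ≠ C → i ∈ C'.1 → 0 ≤ y C' ∧ y C' ≤ s.weight C' :=
      fun i hi C' hne hC' => ⟨(hyb C' ⟨i, hi, hC'⟩).1, hy C' hne ⟨i, hi, hC'⟩⟩
    obtain ⟨i, hi, hiC⟩ := hbip.exists_mem_left C
    obtain ⟨j, hj, hjC⟩ := hbip.symm.exists_mem_left C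
    have hyC' := (hyb C ⟨i, hiC, hiC⟩).2
    -- Neither end of a blocking edge that has room below its original capacity can be saturated on
    -- it.
    have hblock : ∀ k ∈ C.1, s.weight C < Γ.capacity C →
        ¬ Saturated f k C s.weight (s.weight C) := fun k hk hlt hsat =>
      hval k hk (hsat.value_le hf h.weight_int h.weight_nonneg hcap (h.gain_nonneg k)
        (add_one_le_of_lt (h.weight_int C) (hint.1 C) hlt) hyC hyC' (hy' k hk) (hload k hk))
    rcases (h.weight_le C).lt_or_eq with hlt | heq
    · refine hblock i hiC (hlt.trans_le (h.cap_le C)) ?_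
      rcases (h.load_le i).lt_or_eq with hb | hb
      · exact Or.inl ((h.locallyOptimal_proposal hf hint hbip hp hi).gain_nonpos C hiC hlt hb)
      · exact Or.inr ⟨hb, fun C' hC' hpos => h.exchange i hi C' C hC' hiC hpos hlt⟩
    · rcases (h.cap_le C).lt_or_eq with hlt | heq'
      · exact hblock j hjC (heq.trans_lt hlt) (heq ▸ h.saturated j hj C hjC hlt)
      -- At the original capacity the deviation only lowers edges of `i`, which does not pay.
      · refine hval i hiC (value_le_of_le hf h.weight_int hcap (h.gain_nonneg i) fun C' hC' => ?_)
        by_cases hne : C' = C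
        · subst hne
          exact ⟨(hyb _ ⟨i, hiC, hiC⟩).1, hyC'.trans (heq.trans heq').ge⟩
        · exact hy' i hiC C' hne hC'

end GDAInvariant

theorem GDAReaches.invariant (hf : Γ.IsDecomposition f c) (hint : Γ.IntegralConstraints)
    (hbip : Γ.IsBipartition U V) {n : ℕ} (h : Γ.GDAReaches τU τV U V n s) :
    GDAInvariant f U V s := by
  induction h with
  | init => exact GDAInvariant.init hint
  | step _ hp _ hr ih => exact ih.next hf hint hbip hp hr

theorem GDAReaches.add_sum_gap_le (hf : Γ.IsDecomposition f c) (hint : Γ.IntegralConstraints)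
    (hbip : Γ.IsBipartition U V) {n : ℕ} (h : Γ.GDAReaches τU τV U V n s) :
    n + ∑ C, (s.cap C - s.weight C) ≤ ∑ C, Γ.capacity C := by
  induction h with
  | init => simp [gdaInit]
  | step hs hp hne hr ih =>
    have := (hs.invariant hf hint hbip).sum_gap_next hbip hp hne hr
    push_cast
    linarith

theorem GDAReaches.le_sum_capacity (hf : Γ.IsDecomposition f c) (hint : Γ.IntegralConstraints)
    (hbip : Γ.IsBipartition U V) {n : ℕ} (h : Γ.GDAReaches τU τV U V n s) :
    (n : ℝ) ≤ ∑ C, Γ.capacity C := by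
  have h1 := h.add_sum_gap_le hf hint hbip
  have h2 : 0 ≤ ∑ C, (s.cap C - s.weight C) :=
    Finset.sum_nonneg fun C _ => sub_nonneg.2 ((h.invariant hf hint hbip).weight_le C)
  linarith

/-- If no execution returned, every reached state could be continued, contradicting the bound on the
number of steps. -/
theorem exists_gdaReturns (hf : Γ.IsDecomposition f c) (hint : Γ.IntegralConstraints)
    (hbip : Γ.IsBipartition U V) (τU τV : TieRule) : ∃ n x, Γ.GDAReturns τU τV U V n x := by
  by_contra! hno
  have hreach : ∀ n, ∃ s, Γ.GDAReaches τU τV U V n s := by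
    intro n
    induction n with
    | zero => exact ⟨_, GDAReaches.init⟩
    | succ n ih =>
      obtain ⟨s, hs⟩ := ih
      have hinv := hs.invariant hf hint hbip
      obtain ⟨p, hp⟩ := hinv.exists_isProposal hf hint hbip τU
      obtain ⟨r, hr⟩ := hinv.exists_isDisposal hf hint hbip hp τV
      exact ⟨_, hs.step hp (fun he => hno n _ ⟨s, hs, he ▸ hp, rfl⟩) hr⟩
  obtain ⟨n, hn⟩ := exists_nat_gt (∑ C, Γ.capacity C)
  obtain ⟨s, hs⟩ := hreach n
  exact (hs.le_sum_capacity hf hint hbip).not_gt hn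

end Algorithm

end NetworkGame

/-- Conclusion: no execution gets stuck, none makes more than `∑ C, α C` full steps, at least one
returns, and whatever an execution returns is a fully stable integral network. -/
theorem mainTheorem8 {N : Type*} [Fintype N] [DecidableEq N] (Γ : NetworkGame N)
    (U V : Set N) (hbip : Γ.IsBipartition U V)
    (hcont : Γ.Continuous) (hsep : Γ.Separable) (hconc : Γ.Concave) (hext : Γ.NoExternalities)
    (hint : Γ.IntegralConstraints) (haff : Γ.PiecewiseAffine)
    (τU τV : NetworkGame.TieRule) :
    (∀ n s, Γ.GDAReaches τU τV U V n s →
      (∃ p, Γ.IsProposal τU U s p) ∧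
      ∀ p, Γ.IsProposal τU U s p → ∃ r, Γ.IsDisposal τV V p r) ∧
    (∀ n s, Γ.GDAReaches τU τV U V n s → (n : ℝ) ≤ ∑ C, Γ.capacity C) ∧
    (∃ n x, Γ.GDAReturns τU τV U V n x) ∧
    (∀ n x, Γ.GDAReturns τU τV U V n x → Γ.FullyStable x ∧ Γ.IsIntegral x) := by
  obtain ⟨f, c, hf⟩ := NetworkGame.exists_isDecomposition hsep hconc hext haff
  refine ⟨fun n s hs => ?_, fun n s hs => hs.le_sum_capacity hf hint hbip,
    NetworkGame.exists_gdaReturns hf hint hbip τU τV, ?_⟩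
  · have hinv := hs.invariant hf hint hbip
    exact ⟨hinv.exists_isProposal hf hint hbip τU,
      fun p hp => hinv.exists_isDisposal hf hint hbip hp τV⟩
  · rintro n x ⟨s, hs, hp, rfl⟩
    have hinv := hs.invariant hf hint hbip
    exact ⟨hinv.fullyStable hf hint hbip hp, hinv.weight_int⟩
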